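/- For a domain $A$ let $A^+$ denote its absolute integral closure, that is, the integral closure of $A$ in an algebraic closure of its fraction field. A ring map $R \to S$ is quasi-finite if it is of finite type and has finite fibers on spectra. A map $M \to N$ of $R$-modules is pure if $M \otimes_R P \to N \otimes_R P$ is injective for every $R$-module $P$. A splinter is a Noetherian ring $R$ such that every finite ring map $R \to T$ inducing a surjection $\operatorname{Spec}(T) \to \operatorname{Spec}(R)$ has an $R$-linear left inverse. Let $R \hookrightarrow S$ be a quasi-finite extension of domains (not necessarily Noetherian) such that the induced map $\operatorname{Spec}(S) \to \operatorname{Spec}(R)$ is surjective, and suppose that $R$ is integrally closed in its fraction field. Then: 1. $S$ can be identified, as an $R$-algebra, with a subring of $\operatorname{Frac}(R^+)$. 2. For every ideal $I$ of $R$, $IS \cap R \subseteq IR^+ \cap R$. 3. For every ideal $I$ of $R$, $IS^+ \cap R = IR^+ \cap R$. 4. If $R$ is a splinter, then $R \to S$ is pure as a map of $R$-modules. -/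

import Mathlib

universe w u v v₁ v₂

/-- The absolute integral closure `R⁺` of a domain `R`: the integral closure of `R` in the
algebraic closure of its fraction field. -/
def AbsIntClosure (R : Type u) [CommRing R] [IsDomain R] : Type u :=
  integralClosure R (AlgebraicClosure (FractionRing R))

noncomputable instance (R : Type u) [CommRing R] [IsDomain R] : CommRing (AbsIntClosure R) :=
  inferInstanceAs (CommRing (integralClosure R (AlgebraicClosure (FractionRing R))))

instance (R : Type u) [CommRing R] [IsDomain R] : IsDomain (AbsIntClosure R) :=
  inferInstanceAs (IsDomain (integralClosure R (AlgebraicClosure (FractionRing R))))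

noncomputable instance (R : Type u) [CommRing R] [IsDomain R] : Algebra R (AbsIntClosure R) :=
  inferInstanceAs (Algebra R (integralClosure R (AlgebraicClosure (FractionRing R))))

/-- A map of `A`-modules `f : M → N` is pure (universally injective) if `M ⊗ P → N ⊗ P` is injective
for all `A`-modules `P`. The universe `w` of `P` is a parameter, so that it can be left arbitrary. -/
def IsPureMap {A : Type u} [CommRing A] {M : Type v₁} {N : Type v₂}
    [AddCommGroup M] [Module A M] [AddCommGroup N] [Module A N] (f : M →ₗ[A] N) : Prop :=
  ∀ (P : Type w) [AddCommGroup P] [Module A P], Function.Injective (f.rTensor P)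

/-- A splinter: a Noetherian ring `R` such that every finite ring map `R → T` that is surjective
on spectra has an `R`-linear left inverse. (A finite `R`-algebra is a quotient of a polynomial ring
in finitely many variables, so algebras in the universe of `R` are all of them up to
isomorphism.) -/
structure IsSplinter (R : Type u) [CommRing R] : Prop where
  isNoetherianRing : IsNoetherianRing R
  exists_leftInverse : ∀ (T : Type u) [CommRing T] [Algebra R T], Module.Finite R T →
    Function.Surjective (PrimeSpectrum.comap (algebraMap R T)) →
    ∃ g : T →ₗ[R] R, g ∘ₗ Algebra.linearMap R T = LinearMap.id

open TensorProduct Polynomial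

/-! Everything reduces to one claim: if `x` in an `R`-module `P` dies in `S ⊗ P`, it dies in `B ⊗
P`, where `B` is the integral closure of `R` in an algebraic closure `L` of its fraction field.
Otherwise the annihilator `J` of `1 ⊗ x` in `B` lies in a maximal ideal `Q`. Choose `q` in `Spec S`
over `Q ∩ R`. Zariski's main theorem gives `f ∉ q`, integral over `R`, such that every element of
`S` becomes integral over `R` after multiplication by a power of `f`. Embed `S` in `L`; then some
power of `f` kills `1 ⊗ x` in `B ⊗ P`, and so does the same power of each conjugate of `f`. As `R`
is normal, some conjugate avoids `Q`, contradicting `J ≤ Q`.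

Taking `P = R/I` gives the ideal statements; `S⁺` is handled through its subalgebras finite over
`S`, which remain quasi-finite over `R`. For a splinter, vanishing in `B ⊗ P` forces `x = 0`. -/

/-- For a normal domain `R` and a normal field extension `L` of its fraction field, an element of
the integral closure of `R` in `L` outside a prime `P` has, for every prime `Q` with the same
contraction to `R`, a conjugate outside `Q`. -/
lemma integralClosure.exists_algHom_apply_notMem {R K L : Type*} [CommRing R] [IsDomain R]
    [IsIntegrallyClosed R] [Field K] [Algebra R K] [IsFractionRing R K] [Field L] [Algebra K L]
    [Algebra R L] [IsScalarTower R K L] [Normal K L] (P Q : Ideal (integralClosure R L))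
    [P.IsPrime] (h : P.under R = Q.under R) (f : integralClosure R L)
    (hf : f ∉ P) : ∃ σ : integralClosure R L →ₐ[R] integralClosure R L, σ f ∉ Q := by
  classical
  -- If all conjugates lie in `Q`, the minimal polynomial of `f` is `X ^ n` modulo `Q`. Normality
  -- puts its coefficients in `R`, where `P` and `Q` agree, so it is `X ^ n` modulo `P` too and `f ^
  -- n ∈ P`.
  by_contra! hσ
  have hint : IsIntegral R (f : L) := f.2
  set g := minpoly R (f : L) with hg
  have hgm : g.Monic := minpoly.monic hint
  have hgK : minpoly K (f : L) = g.map (algebraMap R K) :=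
    minpoly.isIntegrallyClosed_eq_field_fractions' K hint
  have hgL : (minpoly K (f : L)).map (algebraMap K L) = g.map (algebraMap R L) := by
    rw [hgK, Polynomial.map_map, ← IsScalarTower.algebraMap_eq]
  have hsplit := (Normal.splits (F := K) inferInstance (f : L)).eq_prod_roots
  rw [hgL, (hgm.map _).leadingCoeff, C_1, one_mul] at hsplit
  have hroot : ∀ a ∈ (g.map (algebraMap R L)).roots, a ∈ integralClosure R L := fun a ha ↦ by
    refine ⟨g, hgm, ?_⟩
    rw [← eval_map]
    exact (mem_roots'.mp ha).2
  lift (g.map (algebraMap R L)).roots to Multiset (integralClosure R L) using hroot with s hs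
  have hB : g.map (algebraMap R (integralClosure R L)) = (s.map (X - C ·)).prod := by
    apply Polynomial.map_injective (algebraMap (integralClosure R L) L) Subtype.val_injective
    rw [Polynomial.map_map, ← IsScalarTower.algebraMap_eq, hsplit, Polynomial.map_multiset_prod,
      Multiset.map_map, Multiset.map_map]
    congr 1
    refine Multiset.map_congr rfl fun b _ ↦ ?_
    simp
  have hmem : ∀ b ∈ s, b ∈ Q := fun b hb ↦ by
    have hb' : aeval (b : L) (minpoly K (f : L)) = 0 := by
      rw [aeval_def, ← eval_map, hgL]
      have : (b : L) ∈ (g.map (algebraMap R L)).roots := by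
        rw [← hs]; exact Multiset.mem_map_of_mem _ hb
      exact (mem_roots'.mp this).2
    obtain ⟨φ, hφ⟩ := IntermediateField.exists_algHom_of_splits_of_aeval
      (fun x ↦ ⟨(Normal.isIntegral (F := K) inferInstance x),
        Normal.splits (F := K) inferInstance x⟩) hb'
    have := hσ (φ.restrictScalars R).mapIntegralClosure
    convert this
    exact Subtype.ext hφ.symm
  have hQ : g.map (algebraMap R (integralClosure R L ⧸ Q)) = X ^ s.card := by
    rw [IsScalarTower.algebraMap_eq R (integralClosure R L) (_ ⧸ Q), ← Polynomial.map_map, hB,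
      Polynomial.map_multiset_prod, Multiset.map_map, Multiset.map_congr rfl (g := fun _ ↦ X),
      Multiset.map_const', Multiset.prod_replicate]
    intro b hb
    simp [Ideal.Quotient.eq_zero_iff_mem.mpr (hmem b hb)]
  have hcard : g.natDegree = s.card := by
    rw [← hgm.natDegree_map (algebraMap R (integralClosure R L)), hB,
      natDegree_multiset_prod_X_sub_C_eq_card]
  have hP : g.map (algebraMap R (integralClosure R L ⧸ P)) = X ^ s.card := by
    ext i
    rw [coeff_map, coeff_X_pow]
    split_ifs with hi
    · rw [hi, ← hcard, hgm.coeff_natDegree, map_one]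
    · have := congr(coeff $hQ i)
      rw [coeff_map, coeff_X_pow, if_neg hi,
        IsScalarTower.algebraMap_apply R (integralClosure R L) (_ ⧸ Q)] at this
      have : g.coeff i ∈ Q.under R := Ideal.mem_comap.mpr (Ideal.Quotient.eq_zero_iff_mem.mp this)
      rw [← h] at this
      exact Ideal.Quotient.eq_zero_iff_mem.mpr this
  have h0 : aeval f g = 0 := by
    apply Subtype.val_injective
    have := minpoly.aeval R (f : L)
    rw [← hg] at this
    rw [← Subalgebra.coe_val, ← aeval_algHom_apply]
    simpa using this
  have h1 : (Ideal.Quotient.mk P f) ^ s.card = 0 := by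
    have := congr(Ideal.Quotient.mkₐ R P $h0)
    rw [← aeval_algHom_apply, aeval_def, ← eval_map, hP] at this
    simpa using this
  exact hf (Ideal.Quotient.eq_zero_iff_mem.mp (eq_zero_of_pow_eq_zero h1))

/-- If `1 ⊗ x` vanishes in `A ⊗ P`, it already vanishes in `N ⊗ P` for a finitely generated
submodule `N` of `A`. -/
lemma TensorProduct.exists_fg_one_tmul_eq_zero {R A P : Type*} [CommRing R] [CommRing A]
    [Algebra R A] [AddCommGroup P] [Module R P] (x : P) (hx : (1 : A) ⊗ₜ[R] x = 0) :
    ∃ (N : Submodule R A) (h : 1 ∈ N), N.FG ∧ (⟨1, h⟩ : N) ⊗ₜ[R] x = 0 := by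
  have h1 : (1 : A) ∈ R ∙ (1 : A) := Submodule.mem_span_singleton_self _
  -- The tensor is viewed over the span of `1`, so that the submodule obtained contains `1`.
  obtain ⟨N, hN, hfg, h⟩ := TensorProduct.eq_zero_of_fg_of_subtype_eq_zero (R := R)
    (Submodule.fg_span_singleton (1 : A)) (t := (⟨1, h1⟩ : (R ∙ (1 : A) : Submodule R A)) ⊗ₜ[R] x)
    (by simpa using hx)
  exact ⟨N, hN h1, hfg, by simpa only [LinearMap.rTensor_tmul] using! h⟩

lemma TensorProduct.one_tmul_eq_zero_of_algHom {R A B P : Type*} [CommRing R] [CommRing A]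
    [Algebra R A] [CommRing B] [Algebra R B] [AddCommGroup P] [Module R P] (φ : A →ₐ[R] B) {x : P}
    (hx : (1 : A) ⊗ₜ[R] x = 0) : (1 : B) ⊗ₜ[R] x = 0 := by
  simpa using congr(φ.toLinearMap.rTensor P $hx)

/-- Since `A / IA` is `A ⊗ R/I`, contraction of extended ideals is the case `P = R/I` of the
vanishing of `1 ⊗ x`. -/
lemma Ideal.mem_comap_map_iff_one_tmul_eq_zero {R A : Type*} [CommRing R] [CommRing A]
    [Algebra R A] (I : Ideal R) (a : R) :
    a ∈ (I.map (algebraMap R A)).comap (algebraMap R A) ↔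
      (1 : A) ⊗ₜ[R] (Ideal.Quotient.mk I a) = 0 := by
  rw [← (Algebra.TensorProduct.quotIdealMapEquivTensorQuot A I).symm.map_eq_zero_iff]
  erw [Algebra.TensorProduct.quotIdealMapEquivTensorQuot_symm_tmul]
  rw [Ideal.mem_comap, Submodule.Quotient.mk_eq_zero, Algebra.algebraMap_eq_smul_one]

/-- A quasi-finite extension of domains is algebraic. -/
lemma Algebra.QuasiFinite.isAlgebraic {R S : Type*} [CommRing R] [IsDomain R] [CommRing S]
    [IsDomain S] [Algebra R S] [Algebra.QuasiFinite R S] [FaithfulSMul R S] :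
    Algebra.IsAlgebraic R S := by
  let := FractionRing.liftAlgebra R (FractionRing S)
  have := FractionRing.isScalarTower_liftAlgebra R (FractionRing S)
  have := Algebra.QuasiFinite.of_isLocalization (R := R) (S := S) (T := FractionRing S)
    (nonZeroDivisors S)
  have := Algebra.QuasiFinite.of_restrictScalars R (FractionRing R) (FractionRing S)
  have := Module.Finite.of_quasiFinite (R := FractionRing R) (S := FractionRing S)
  have : Algebra.IsAlgebraic R (FractionRing S) :=
    (IsFractionRing.comap_isAlgebraic_iff (K := FractionRing R)).mpr inferInstance
  exact Algebra.IsAlgebraic.of_injective (IsScalarTower.toAlgHom R S (FractionRing S))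
    (IsFractionRing.injective S _)

/-- An algebraic extension of domains embeds into every algebraically closed extension. -/
lemma IsAlgClosed.exists_injective_algHom {R S L : Type*} [CommRing R] [IsDomain R] [CommRing S]
    [IsDomain S] [Algebra R S] [FaithfulSMul R S] [Algebra.IsAlgebraic R S] [Field L]
    [Algebra R L] [FaithfulSMul R L] [IsAlgClosed L] :
    ∃ φ : S →ₐ[R] L, Function.Injective φ := by
  have : Algebra.IsAlgebraic R (FractionRing S) :=
    have := IsLocalization.isAlgebraic (FractionRing S) (nonZeroDivisors S)
    Algebra.IsAlgebraic.trans R S _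
  let φ : FractionRing S →ₐ[R] L := IsAlgClosed.lift
  exact ⟨φ.comp (IsScalarTower.toAlgHom R S (FractionRing S)),
    (φ : FractionRing S →+* L).injective.comp (IsFractionRing.injective S (FractionRing S))⟩

/-- Let `S` be a quasi-finite extension domain of the normal domain `R` that is surjective on
spectra, and `L` an algebraically closed algebraic extension of the fraction field of `R`. Every
element of an `R`-module that dies in the base change to `S` dies in the base change to the
integral closure of `R` in `L`. -/
theorem integralClosure.one_tmul_eq_zero_of_quasiFinite {R S K L P : Type*} [CommRing R]
    [IsDomain R] [IsIntegrallyClosed R] [CommRing S] [IsDomain S] [Algebra R S] [FaithfulSMul R S]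
    [Algebra.FiniteType R S] [Algebra.QuasiFinite R S]
    (hspec : Function.Surjective (PrimeSpectrum.comap (algebraMap R S)))
    [Field K] [Algebra R K] [IsFractionRing R K] [Field L] [Algebra K L] [Algebra R L]
    [IsScalarTower R K L] [Normal K L] [IsAlgClosed L] [AddCommGroup P] [Module R P] (x : P)
    (hx : (1 : S) ⊗ₜ[R] x = 0) : (1 : integralClosure R L) ⊗ₜ[R] x = 0 := by
  have : FaithfulSMul R L := by
    rw [faithfulSMul_iff_algebraMap_injective, IsScalarTower.algebraMap_eq R K L]
    exact (algebraMap K L).injective.comp (IsFractionRing.injective R K)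
  let J : Ideal (integralClosure R L) :=
    LinearMap.ker (LinearMap.toSpanSingleton (integralClosure R L) (integralClosure R L ⊗[R] P)
      (1 ⊗ₜ x))
  have hJ (b : integralClosure R L) : b ∈ J ↔ b ⊗ₜ[R] x = 0 := by
    simp [J, TensorProduct.smul_tmul']
  suffices J = ⊤ from (hJ 1).mp (this ▸ Submodule.mem_top)
  by_contra hJtop
  obtain ⟨Q, hQ, hJQ⟩ := Ideal.exists_le_maximal J hJtop
  obtain ⟨q, hq⟩ := hspec ⟨Q.under R, inferInstance⟩
  replace hq : q.asIdeal.under R = Q.under R := congr(($hq).asIdeal)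
  obtain ⟨f, hfq, hf, hfS⟩ := Algebra.zariskisMainProperty_iff.mp
    (Algebra.ZariskisMainProperty.of_finiteType (R := R) q.asIdeal)
  have := Algebra.QuasiFinite.isAlgebraic (R := R) (S := S)
  obtain ⟨φ, hφ⟩ := IsAlgClosed.exists_injective_algHom (R := R) (S := S) (L := L)
  let ψ : integralClosure R S →ₐ[R] integralClosure R L := φ.mapIntegralClosure
  have hψ : Function.Injective ψ := fun a b hab ↦ Subtype.ext (hφ congr(($hab : L)))
  -- Lying over along the integral extension `ψ`: `P'` plays the role of `q` in the integral closure
  -- of `R` in `L`, so it avoids `ψ f'`, but it need not equal `Q`.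
  obtain ⟨P', hP', hP'q⟩ : ∃ P' : Ideal (integralClosure R L), P'.IsPrime ∧
      P'.comap ψ = q.asIdeal.under (integralClosure R S) := by
    let := ψ.toRingHom.toAlgebra
    have : IsScalarTower R (integralClosure R S) (integralClosure R L) :=
      .of_algebraMap_eq fun r ↦ (ψ.commutes r).symm
    have : Algebra.IsIntegral (integralClosure R S) (integralClosure R L) :=
      .tower_top R
    obtain ⟨P', hP', h⟩ := Ideal.exists_ideal_over_prime_of_isIntegral_of_isDomain
      (S := integralClosure R L) (q.asIdeal.under (integralClosure R S))
      (((RingHom.injective_iff_ker_eq_bot _).mp hψ).trans_le bot_le)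
    exact ⟨P', hP', h⟩
  let f' : integralClosure R S := ⟨f, hf⟩
  have hfP' : ψ f' ∉ P' := fun h ↦ hfq <| by
    have : f' ∈ P'.comap ψ := h
    rwa [hP'q] at this
  have hP'Q : P'.under R = Q.under R := by
    rw [← hq]
    have := congr(($hP'q).comap (algebraMap R (integralClosure R S)))
    ext r
    have := congr(r ∈ $this)
    simp only [Ideal.mem_comap, AlgHom.commutes] at this
    exact this.to_iff
  obtain ⟨σ, hσ⟩ := integralClosure.exists_algHom_apply_notMem (K := K) P' Q hP'Q _ hfP'
  obtain ⟨N, h1N, ⟨t, ht⟩, hN0⟩ := TensorProduct.exists_fg_one_tmul_eq_zero x hx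
  -- Finite generation of `N` is what lets a single power of `f`, the largest one needed by a
  -- generator, carry all of `N` into the integral closure.
  choose m hm using hfS
  have hN : ∀ s ∈ N, f ^ (t.sup m) * s ∈ Subalgebra.toSubmodule (integralClosure R S) := by
    rw [← ht]
    intro s hs
    induction hs using Submodule.span_induction with
    | mem s hs =>
      obtain ⟨k, hk⟩ := Nat.exists_eq_add_of_le' (Finset.le_sup (f := m) hs)
      rw [hk, pow_add, mul_assoc]
      exact (hf.pow k).mul (hm s)
    | zero => simp
    | add a b _ _ ha hb => rw [mul_add]; exact add_mem ha hb
    | smul r a _ ha => rw [mul_smul_comm]; exact Submodule.smul_mem _ r ha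
  let mulN : N →ₗ[R] integralClosure R S :=
    (LinearMap.mulLeft R (f ^ t.sup m)).restrict hN
  -- Multiplication by the power of `f` is only `R`-linear, which suffices to transport the relation
  -- `1 ⊗ x = 0`; it becomes `σ (ψ f') ^ n ⊗ x = 0`.
  have key := congr((σ.toLinearMap ∘ₗ ψ.toLinearMap ∘ₗ mulN).rTensor P $hN0)
  have hval : mulN ⟨1, h1N⟩ = f' ^ t.sup m := Subtype.ext (mul_one _)
  simp only [LinearMap.rTensor_tmul, LinearMap.comp_apply, hval, AlgHom.toLinearMap_apply,
    map_pow, map_zero] at key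
  exact hσ (hQ.isPrime.mem_of_pow_mem _ (hJQ ((hJ _).mpr key)))

/-- The same as `integralClosure.one_tmul_eq_zero_of_quasiFinite` for the base change to an
integral extension `T` of `S`. -/
theorem integralClosure.one_tmul_eq_zero_of_isIntegral_quasiFinite {R S T K L P : Type*}
    [CommRing R] [IsDomain R] [IsIntegrallyClosed R] [CommRing S] [IsDomain S] [Algebra R S]
    [FaithfulSMul R S] [Algebra.FiniteType R S] [Algebra.QuasiFinite R S]
    (hspec : Function.Surjective (PrimeSpectrum.comap (algebraMap R S)))
    [CommRing T] [IsDomain T] [Algebra S T] [FaithfulSMul S T] [Algebra R T] [IsScalarTower R S T]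
    [Algebra.IsIntegral S T]
    [Field K] [Algebra R K] [IsFractionRing R K] [Field L] [Algebra K L] [Algebra R L]
    [IsScalarTower R K L] [Normal K L] [IsAlgClosed L] [AddCommGroup P] [Module R P] (x : P)
    (hx : (1 : T) ⊗ₜ[R] x = 0) : (1 : integralClosure R L) ⊗ₜ[R] x = 0 := by
  obtain ⟨N, h1N, ⟨t, ht⟩, hN0⟩ := TensorProduct.exists_fg_one_tmul_eq_zero x hx
  -- The vanishing involves only finitely many elements of `T`; adjoining them gives an algebra
  -- finite over `S`, to which the quasi-finite case applies.
  let A : Subalgebra S T := Algebra.adjoin S t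
  have : Module.Finite S A := .of_fg <|
    fg_adjoin_of_finite t.finite_toSet fun a _ ↦ Algebra.IsIntegral.isIntegral a
  have : Algebra.FiniteType R A := .trans ‹Algebra.FiniteType R S› inferInstance
  have : Algebra.QuasiFinite R A := .trans R S A
  have hSA : Function.Injective (algebraMap S A) := FaithfulSMul.algebraMap_injective S A
  have : FaithfulSMul R A := by
    rw [faithfulSMul_iff_algebraMap_injective, IsScalarTower.algebraMap_eq R S A]
    exact hSA.comp (FaithfulSMul.algebraMap_injective R S)
  have hNA : N ≤ (Subalgebra.toSubmodule A).restrictScalars R := by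
    rw [← ht, Submodule.span_le]
    exact Algebra.subset_adjoin
  refine integralClosure.one_tmul_eq_zero_of_quasiFinite (S := A) (K := K) ?_ x ?_
  · rw [IsScalarTower.algebraMap_eq R S A, PrimeSpectrum.comap_comp]
    exact hspec.comp (Algebra.IsIntegral.comap_surjective S A)
  · exact congr((Submodule.inclusion hNA : N →ₗ[R] A).rTensor P $hN0)

lemma Subalgebra.faithfulSMul {R B : Type*} [CommRing R] [CommRing B] [Algebra R B]
    [FaithfulSMul R B] (A : Subalgebra R B) : FaithfulSMul R A := by
  rw [faithfulSMul_iff_algebraMap_injective]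
  exact .of_comp (f := A.val) (FaithfulSMul.algebraMap_injective R B)

lemma AlgebraicClosure.faithfulSMul_fractionRing (R : Type*) [CommRing R] [IsDomain R] :
    FaithfulSMul R (AlgebraicClosure (FractionRing R)) :=
  .trans R (FractionRing R) _

lemma AbsIntClosure.faithfulSMul (R : Type*) [CommRing R] [IsDomain R] :
    FaithfulSMul R (AbsIntClosure R) :=
  have := AlgebraicClosure.faithfulSMul_fractionRing R
  Subalgebra.faithfulSMul (integralClosure R (AlgebraicClosure (FractionRing R)))

lemma AbsIntClosure.isIntegral (R : Type*) [CommRing R] [IsDomain R] :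
    Algebra.IsIntegral R (AbsIntClosure R) :=
  inferInstanceAs (Algebra.IsIntegral R (integralClosure R (AlgebraicClosure (FractionRing R))))

/-- A splinter is pure in each of its integral extensions. -/
lemma IsSplinter.eq_zero_of_one_tmul_eq_zero {R B : Type u} [CommRing R] (hR : IsSplinter R)
    [CommRing B] [Algebra R B] [FaithfulSMul R B] [Algebra.IsIntegral R B] {P : Type*}
    [AddCommGroup P] [Module R P] (x : P) (hx : (1 : B) ⊗ₜ[R] x = 0) : x = 0 := by
  obtain ⟨N, h1N, ⟨t, ht⟩, hN0⟩ := TensorProduct.exists_fg_one_tmul_eq_zero x hx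
  let A : Subalgebra R B := Algebra.adjoin R t
  have hA : Module.Finite R A := .of_fg <|
    fg_adjoin_of_finite t.finite_toSet fun a _ ↦ Algebra.IsIntegral.isIntegral a
  have := A.faithfulSMul
  obtain ⟨g, hg⟩ := hR.exists_leftInverse A hA (Algebra.IsIntegral.comap_surjective R A)
  have hNA : N ≤ Subalgebra.toSubmodule A := by
    rw [← ht, Submodule.span_le]
    exact Algebra.subset_adjoin
  have h1 : (1 : A) ⊗ₜ[R] x = 0 := congr((Submodule.inclusion hNA : N →ₗ[R] A).rTensor P $hN0)
  have hg1 : g 1 = 1 := by simpa using LinearMap.congr_fun hg 1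
  simpa [hg1] using congr(TensorProduct.lid R P (g.rTensor P $h1))

/-- An integral extension of domains `R → B` factors through the integral closure of `S` in an
algebraically closed extension, for every extension `S` of `R`. -/
lemma IsAlgClosed.nonempty_algHom_integralClosure {R S B L : Type*} [CommRing R] [IsDomain R]
    [CommRing S] [Algebra R S] [CommRing B] [IsDomain B] [Algebra R B]
    [FaithfulSMul R B] [Algebra.IsIntegral R B] [Field L] [Algebra R L] [Algebra S L]
    [IsScalarTower R S L] [FaithfulSMul R L] [IsAlgClosed L] :
    Nonempty (B →ₐ[R] integralClosure S L) := by
  obtain ⟨φ, -⟩ := IsAlgClosed.exists_injective_algHom (R := R) (S := B) (L := L)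
  exact ⟨AlgHom.codRestrict φ ((integralClosure S L).restrictScalars R) fun b ↦
    ((Algebra.IsIntegral.isIntegral (R := R) b).map φ).tower_top⟩

theorem mainTheorem7 {R : Type u} {S : Type v} [CommRing R] [IsDomain R]
    [IsIntegrallyClosed R] [CommRing S] [IsDomain S] [Algebra R S]
    [Algebra.FiniteType R S] [Algebra.QuasiFinite R S]
    (hinj : Function.Injective (algebraMap R S))
    (hspec : Function.Surjective (PrimeSpectrum.comap (algebraMap R S))) :
    (∃ φ : S →ₐ[R] FractionRing (AbsIntClosure R), Function.Injective φ) ∧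
    (∀ I : Ideal R,
      (I.map (algebraMap R S)).comap (algebraMap R S) ≤
        (I.map (algebraMap R (AbsIntClosure R))).comap (algebraMap R (AbsIntClosure R))) ∧
    (∀ I : Ideal R,
      (I.map ((algebraMap S (AbsIntClosure S)).comp (algebraMap R S))).comap
          ((algebraMap S (AbsIntClosure S)).comp (algebraMap R S)) =
        (I.map (algebraMap R (AbsIntClosure R))).comap (algebraMap R (AbsIntClosure R))) ∧
    (IsSplinter R → IsPureMap.{w} (Algebra.linearMap R S)) := by
  have : FaithfulSMul R S := (faithfulSMul_iff_algebraMap_injective R S).mpr hinj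
  have := AbsIntClosure.isIntegral R
  have := AbsIntClosure.faithfulSMul R
  have := AlgebraicClosure.faithfulSMul_fractionRing R
  refine ⟨?_, fun I a ha ↦ ?_, fun I ↦ ?_, fun hR P _ _ ↦ ?_⟩
  · have := Algebra.QuasiFinite.isAlgebraic (R := R) (S := S)
    obtain ⟨φ, hφ⟩ := IsAlgClosed.exists_injective_algHom (R := R) (S := S)
      (L := AlgebraicClosure (FractionRing R))
    have : Algebra.IsAlgebraic R (AlgebraicClosure (FractionRing R)) :=
      (IsFractionRing.comap_isAlgebraic_iff (K := FractionRing R)).mpr inferInstance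
    have : IsFractionRing (integralClosure R (AlgebraicClosure (FractionRing R)))
        (AlgebraicClosure (FractionRing R)) :=
      integralClosure.isFractionRing_of_algebraic fun x hx ↦
        (FaithfulSMul.algebraMap_eq_zero_iff R _).mp hx
    -- The algebraic closure is algebraic over `R`, hence is itself a fraction field of `R⁺`.
    let e : AlgebraicClosure (FractionRing R) ≃ₐ[R] FractionRing (AbsIntClosure R) :=
      (FractionRing.algEquiv (integralClosure R (AlgebraicClosure (FractionRing R)))
        (AlgebraicClosure (FractionRing R))).symm.restrictScalars R
    exact ⟨e.toAlgHom.comp φ, e.injective.comp hφ⟩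
  · rw [Ideal.mem_comap_map_iff_one_tmul_eq_zero] at ha ⊢
    exact integralClosure.one_tmul_eq_zero_of_quasiFinite (K := FractionRing R)
      (L := AlgebraicClosure (FractionRing R)) hspec _ ha
  · let := ((algebraMap S (AbsIntClosure S)).comp (algebraMap R S)).toAlgebra
    have : IsScalarTower R S (AbsIntClosure S) := .of_algebraMap_eq fun _ ↦ rfl
    have := AbsIntClosure.isIntegral S
    have := AbsIntClosure.faithfulSMul S
    have := AlgebraicClosure.faithfulSMul_fractionRing S
    change (I.map (algebraMap R (AbsIntClosure S))).comap (algebraMap R (AbsIntClosure S)) = _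
    ext a
    rw [Ideal.mem_comap_map_iff_one_tmul_eq_zero, Ideal.mem_comap_map_iff_one_tmul_eq_zero]
    constructor
    · exact integralClosure.one_tmul_eq_zero_of_isIntegral_quasiFinite (S := S)
        (T := AbsIntClosure S) (K := FractionRing R)
        (L := AlgebraicClosure (FractionRing R)) hspec _
    · have : FaithfulSMul R (AlgebraicClosure (FractionRing S)) := .trans R S _
      obtain ⟨ψ⟩ := IsAlgClosed.nonempty_algHom_integralClosure (R := R) (S := S)
        (B := AbsIntClosure R) (L := AlgebraicClosure (FractionRing S))
      -- The same ring map, now linear for the `R`-structure that passes through `S`.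
      let ψ' : AbsIntClosure R →ₐ[R] AbsIntClosure S :=
        { toRingHom := ψ.toRingHom
          commutes' := fun r ↦ (ψ.commutes r).trans <|
            Subtype.ext (IsScalarTower.algebraMap_apply R S (AlgebraicClosure (FractionRing S)) r) }
      exact TensorProduct.one_tmul_eq_zero_of_algHom ψ'
  · rw [injective_iff_map_eq_zero]
    intro y hy
    -- Every element of `R ⊗ P` has the form `1 ⊗ x`.
    obtain ⟨x, rfl⟩ := (TensorProduct.lid R P).symm.surjective y
    have hx : (1 : S) ⊗ₜ[R] x = 0 := by simpa using hy
    have hx' : (1 : AbsIntClosure R) ⊗ₜ[R] x = 0 :=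
      integralClosure.one_tmul_eq_zero_of_quasiFinite (K := FractionRing R)
        (L := AlgebraicClosure (FractionRing R)) hspec x hx
    rw [hR.eq_zero_of_one_tmul_eq_zero x hx', map_zero]
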